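/- Let $M$ be a smooth $n$-dimensional manifold. For a bivector field $\pi$ and a 2-form $\omega$ on $M$ write $\tilde\pi\colon T^*M\to TM$, $\tilde\pi\alpha=\pi(\alpha,\cdot)$, and $\tilde\omega\colon TM\to T^*M$, $\tilde\omega X=\omega(X,\cdot)$. Put $T(\pi,\omega)=1+\tilde\pi\tilde\omega\colon TM\to TM$; if $T(\pi,\omega)$ is invertible at every point of $M$, let $\tau_\pi\omega$ be the 2-form with $\widetilde{\tau_\pi\omega}=\tilde\omega\,T(\pi,\omega)^{-1}$ (and, dually, $\tau_\omega\pi$ the bivector field with $\widetilde{\tau_\omega\pi}=\tilde\pi(1+\tilde\omega\tilde\pi)^{-1}$). For a bivector field $\pi$, the Koszul bracket of 1-forms is $$[\alpha,\beta]_\pi=\mathcal L_{\tilde\pi\alpha}\beta-\mathcal L_{\tilde\pi\beta}\alpha-d(\pi(\alpha,\beta)).$$ It is extended to a bracket $\Omega^p(M)\times\Omega^q(M)\to\Omega^{p+q-1}(M)$ on all differential forms by $[f,g]_\pi=0$ and $[\alpha,f]_\pi=(\tilde\pi\alpha)f$ for functions $f,g$ and 1-forms $\alpha$, by $[\alpha,\beta\wedge\gamma]_\pi=[\alpha,\beta]_\pi\wedge\gamma+(-1)^{(|\alpha|-1)|\beta|}\beta\wedge[\alpha,\gamma]_\pi$,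 and by $[\alpha,\beta]_\pi=-(-1)^{(|\alpha|-1)(|\beta|-1)}[\beta,\alpha]_\pi$. When $\pi$ is Poisson, this bracket and the exterior derivative $d$ are the bracket and the differential of the differential graded Lie algebra of differential forms on $M$ (with degrees shifted by one). Let $\pi$ be a Poisson structure on $M$, that is, a smooth bivector field with vanishing Schouten bracket $[\pi,\pi]=0$, and let $\omega$ be a smooth closed 2-form such that the gauge transformation $\tau_{-\omega}\pi$ exists, that is, such that $T(-\pi,\omega)=1-\tilde\pi\tilde\omega$ is invertible at every point of $M$. Then $\omega'=\tau_{-\pi}\omega$ is a smooth 2-form and satisfies the Maurer–Cartan equation $$d\omega'+\tfrac12[\omega',\omega']_\pi=0 .$$ -/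

import Mathlib

open scoped Manifold ContDiff

noncomputable section

namespace PoissonGauge

/-! ### Multilinear algebra -/

section Algebra

variable {W : Type*} [NormedAddCommGroup W] [NormedSpace ℝ W]

/-- The product `v ↦ a (v₀, …, v_{p-1}) * b (v_p, …, v_{m-1})`, where `m = p + q`. -/
def tensorMul {p q m : ℕ} (h : p + q = m) (a : W [⋀^Fin p]→L[ℝ] ℝ) (b : W [⋀^Fin q]→L[ℝ] ℝ) :
    ContinuousMultilinearMap ℝ (fun _ : Fin m => W) ℝ where
  toMultilinearMap :=
    ((LinearMap.mul' ℝ ℝ).compMultilinearMap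
      (MultilinearMap.domCoprod a.toMultilinearMap b.toMultilinearMap)).domDomCongr
        (finSumFinEquiv.trans (finCongr h))
  cont := by
    change Continuous fun v : Fin m → W =>
      a (fun i => v (Fin.cast h (Fin.castAdd q i))) * b (fun j => v (Fin.cast h (Fin.natAdd p j)))
    refine Continuous.mul ?_ ?_
    · exact a.cont.comp (continuous_pi fun i => continuous_apply _)
    · exact b.cont.comp (continuous_pi fun i => continuous_apply _)

/-- The wedge product of alternating maps, normalised by the determinant convention
`(a ∧ b)(v) = (1 / (p! q!)) ∑ σ, sign σ * a (v_{σ 0}, …) * b (v_{σ p}, …)`. -/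
def wedge {p q m : ℕ} (h : p + q = m) (a : W [⋀^Fin p]→L[ℝ] ℝ) (b : W [⋀^Fin q]→L[ℝ] ℝ) :
    W [⋀^Fin m]→L[ℝ] ℝ :=
  ((p.factorial : ℝ) * (q.factorial : ℝ))⁻¹ •
    ContinuousMultilinearMap.alternatization (tensorMul h a b)

theorem wedge_apply {p q m : ℕ} (h : p + q = m) (a : W [⋀^Fin p]→L[ℝ] ℝ)
    (b : W [⋀^Fin q]→L[ℝ] ℝ) (v : Fin m → W) :
    wedge h a b v = ((p.factorial : ℝ) * (q.factorial : ℝ))⁻¹ *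
      ∑ σ : Equiv.Perm (Fin m), ((Equiv.Perm.sign σ : ℤ) : ℝ) *
        (a (fun i => v (σ (Fin.cast h (Fin.castAdd q i)))) *
          b (fun j => v (σ (Fin.cast h (Fin.natAdd p j))))) := by
  have key : ContinuousMultilinearMap.alternatization (tensorMul h a b) v =
      ∑ σ : Equiv.Perm (Fin m), ((Equiv.Perm.sign σ : ℤ) : ℝ) *
        (a (fun i => v (σ (Fin.cast h (Fin.castAdd q i)))) *
          b (fun j => v (σ (Fin.cast h (Fin.natAdd p j))))) := by
    rw [ContinuousMultilinearMap.alternatization_apply_apply]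
    refine Finset.sum_congr rfl fun σ _ => ?_
    rw [Units.smul_def, zsmul_eq_mul]
    rfl
  rw [← key]
  rfl

/-- A linear functional as an alternating map in one variable. -/
def ofFunctional (f : W →L[ℝ] ℝ) : W [⋀^Fin 1]→L[ℝ] ℝ :=
  ContinuousAlternatingMap.ofSubsingleton ℝ W ℝ (0 : Fin 1) f

/-- An alternating map in one variable as a linear functional. -/
def toFunctional (a : W [⋀^Fin 1]→L[ℝ] ℝ) : W →L[ℝ] ℝ :=
  (ContinuousAlternatingMap.ofSubsingleton ℝ W ℝ (0 : Fin 1)).symm a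

/-- A scalar as an alternating map in no variables. -/
def ofScalar (c : ℝ) : W [⋀^Fin 0]→L[ℝ] ℝ :=
  ContinuousAlternatingMap.constOfIsEmpty ℝ W (Fin 0) c

/-- The map `X ↦ w (X, ·)` attached to an alternating bilinear form. -/
def flat (w : W [⋀^Fin 2]→L[ℝ] ℝ) : W →L[ℝ] (W →L[ℝ] ℝ) :=
  ((ContinuousAlternatingMap.ofSubsingletonLIE (𝕜 := ℝ) (E := W) (F := ℝ)
    (0 : Fin 1)).symm.toContinuousLinearEquiv : (W [⋀^Fin 1]→L[ℝ] ℝ) →L[ℝ] (W →L[ℝ] ℝ)).comp w.curryLeft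

theorem flat_apply (w : W [⋀^Fin 2]→L[ℝ] ℝ) (X Y : W) : flat w X Y = w ![X, Y] := by
  change w (Matrix.vecCons X fun _ : Fin 1 => Y) = w ![X, Y]
  congr 1
  ext i
  fin_cases i <;> rfl

end Algebra

/-- The model space `ℝⁿ`. -/
abbrev Model (n : ℕ) : Type := EuclideanSpace ℝ (Fin n)

/-- The dual of the model space. -/
abbrev CoModel (n : ℕ) : Type := Model n →L[ℝ] ℝ

variable {n : ℕ}

/-- The standard basis vector `e_i`. -/
def basisVec (i : Fin n) : Model n := EuclideanSpace.single i (1 : ℝ)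

/-- The standard basis covector `e^i`. -/
def basisCovec (i : Fin n) : CoModel n := EuclideanSpace.proj i

/-- The map `α ↦ P (α, ·)`, from covectors to vectors, attached to a bivector `P`; a bivector is
an alternating bilinear form on covectors. -/
def sharp (P : CoModel n [⋀^Fin 2]→L[ℝ] ℝ) : CoModel n →L[ℝ] Model n :=
  ∑ i, ((ContinuousLinearMap.apply ℝ ℝ (basisCovec i)).comp (flat P)).smulRight (basisVec i)

theorem sharp_apply (P : CoModel n [⋀^Fin 2]→L[ℝ] ℝ) (a b : CoModel n) :
    b (sharp P a) = P ![a, b] := by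
  have hb : b = ∑ i, b (basisVec i) • basisCovec i := by
    ext x
    have hx : x = ∑ i, x i • basisVec i := by
      ext j
      simp [basisVec, Pi.single_apply]
    conv_lhs => rw [hx]
    simp [basisCovec, mul_comm]
  have h1 : b (sharp P a) = ∑ i, flat P a (basisCovec i) * b (basisVec i) := by
    simp [sharp]
  rw [h1, ← flat_apply]
  conv_rhs => rw [hb]
  simp [mul_comm]

/-- `T(P, w) = 1 + P̃ w̃`, an endomorphism of the tangent space. -/
def twistOp (P : CoModel n [⋀^Fin 2]→L[ℝ] ℝ) (w : Model n [⋀^Fin 2]→L[ℝ] ℝ) :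
    Model n →L[ℝ] Model n :=
  1 + (sharp P).comp (flat w)

/-- `τ_P w`: the alternating form whose associated map is `w̃ T(P, w)⁻¹`, for `T(P, w)`
invertible. -/
def tau (P : CoModel n [⋀^Fin 2]→L[ℝ] ℝ) (w : Model n [⋀^Fin 2]→L[ℝ] ℝ)
    (h : IsUnit (twistOp P w)) : Model n [⋀^Fin 2]→L[ℝ] ℝ where
  toFun v := flat w (Ring.inverse (twistOp P w) (v 0)) (v 1)
  map_update_add' := by
    intro _ m i x y
    fin_cases i <;> simp
  map_update_smul' := by
    intro _ m i c x
    fin_cases i <;> simp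
  cont := by fun_prop
  map_eq_zero_of_eq' := by
    intro v i j hv hij
    have key : ∀ X : Model n, flat w (Ring.inverse (twistOp P w) X) X = 0 := by
      intro X
      set Y := Ring.inverse (twistOp P w) X with hY
      have hX : X = twistOp P w Y := by
        have h2 := congrArg (fun L : Model n →L[ℝ] Model n => L X)
          (Ring.mul_inverse_cancel (twistOp P w) h)
        exact h2.symm
      have hX' : X = Y + sharp P (flat w Y) := by
        rw [hX]; rfl
      rw [hX', map_add, sharp_apply, flat_apply,
        w.map_eq_zero_of_eq ![Y, Y] (i := 0) (j := 1) rfl (by decide),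
        P.map_eq_zero_of_eq ![flat w Y, flat w Y] (i := 0) (j := 1) rfl (by decide), add_zero]
    have h01 : v 0 = v 1 := by
      fin_cases i <;> fin_cases j <;> simp_all
    rw [h01]
    exact key (v 1)

theorem flat_tau (P : CoModel n [⋀^Fin 2]→L[ℝ] ℝ) (w : Model n [⋀^Fin 2]→L[ℝ] ℝ)
    (h : IsUnit (twistOp P w)) :
    flat (tau P w h) = (flat w).comp (Ring.inverse (twistOp P w)) := by
  ext X Y
  rw [flat_apply]
  rfl

/-! ### Local calculus on the model space -/

/-- The Lie derivative `ι_X d + d ι_X` of differential forms of positive degree. -/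
def lieDeriv {k : ℕ} (X : Model n → Model n) (β : Model n → Model n [⋀^Fin (k + 1)]→L[ℝ] ℝ)
    (y : Model n) : Model n [⋀^Fin (k + 1)]→L[ℝ] ℝ :=
  (extDeriv β y).curryLeft (X y) + extDeriv (fun z => (β z).curryLeft (X z)) y

/-- The Koszul bracket of 1-forms,
`[α, β]_P = L_{P̃ α} β - L_{P̃ β} α - d (P (α, β))`. -/
def koszulOneForms (P : Model n → CoModel n [⋀^Fin 2]→L[ℝ] ℝ)
    (α β : Model n → Model n [⋀^Fin 1]→L[ℝ] ℝ) (y : Model n) : Model n [⋀^Fin 1]→L[ℝ] ℝ :=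
  lieDeriv (fun z => sharp (P z) (toFunctional (α z))) β y
    - lieDeriv (fun z => sharp (P z) (toFunctional (β z))) α y
    - extDeriv (fun z => ofScalar (P z ![toFunctional (α z), toFunctional (β z)])) y

section Gerstenhaber

variable {W : Type*} [NormedAddCommGroup W] [NormedSpace ℝ W]

/-- The Schouten (Gerstenhaber) bracket of a bundle `A` with a bracket of sections, in a local
frame `a_1, …, a_n` of `A`. Here `e i` is the dual frame of `A*`, whose fibre is `W`; sections of
`⋀^p A` are functions with values in the alternating `p`-forms on `W`;
`ρ i` is the anchor of `a_i`, and `c i j = [a_i, a_j]`.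

It is the extension of `[a_i, f] = ρ(a_i) f` and `[a_i, a_j] = c i j`
to a bracket of degree `-1` on sections of `⋀ A` with
`[S, Q ∧ R] = [S, Q] ∧ R + (-1)^((|S|-1)|Q|) Q ∧ [S, R]` and
`[S, Q] = -(-1)^((|S|-1)(|Q|-1)) [Q, S]`. In the frame,
`[S, Q] = ∑ i, ((-1)^(p-1) ι_i S ∧ ∂_{ρ i} Q - ∂_{ρ i} S ∧ ι_i Q)
  + ∑ i j, (-1)^(p-1) ι_i S ∧ c i j ∧ ι_j Q`,
for `S` of degree `p`, where `ι_i` is the contraction with `e i` (zero in degree `0`) and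
`∂` differentiates components in the frame. -/
def schoutenFrame (e : Fin n → W) (ρ : Fin n → Model n → Model n)
    (c : Fin n → Fin n → Model n → W [⋀^Fin 1]→L[ℝ] ℝ) :
    {p q m : ℕ} → p + q = m + 1 → (Model n → W [⋀^Fin p]→L[ℝ] ℝ) →
      (Model n → W [⋀^Fin q]→L[ℝ] ℝ) → Model n → W [⋀^Fin m]→L[ℝ] ℝ
  | 0, 0, _, _, _, _, _ => 0
  | 0, q + 1, m, h, S, Q, y =>
      -∑ i, wedge (show 0 + q = m by omega) (fderiv ℝ S y (ρ i y)) ((Q y).curryLeft (e i))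
  | p + 1, 0, m, h, S, Q, y =>
      ∑ i, (-1 : ℝ) ^ p •
        wedge (show p + 0 = m by omega) ((S y).curryLeft (e i)) (fderiv ℝ Q y (ρ i y))
  | p + 1, q + 1, m, h, S, Q, y =>
      ∑ i, ((-1 : ℝ) ^ p •
          wedge (show p + (q + 1) = m by omega) ((S y).curryLeft (e i)) (fderiv ℝ Q y (ρ i y))
        - wedge (show (p + 1) + q = m by omega) (fderiv ℝ S y (ρ i y)) ((Q y).curryLeft (e i)))
      + ∑ i, ∑ j, (-1 : ℝ) ^ p •
          wedge (show (p + 1) + q = m by omega)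
            (wedge rfl ((S y).curryLeft (e i)) (c i j y)) ((Q y).curryLeft (e j))

end Gerstenhaber

/-- The Schouten bracket of multivector fields on the model space: the bracket of `A = T`, with
frame `e_i`, the identity as anchor and `[e_i, e_j] = 0`. -/
def schoutenModel {p q m : ℕ} (h : p + q = m + 1) (S : Model n → CoModel n [⋀^Fin p]→L[ℝ] ℝ)
    (Q : Model n → CoModel n [⋀^Fin q]→L[ℝ] ℝ) : Model n → CoModel n [⋀^Fin m]→L[ℝ] ℝ :=
  schoutenFrame basisCovec (fun i _ => basisVec i) (fun _ _ _ => 0) h S Q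

/-- The Koszul bracket of differential forms on the model space: the bracket of `A = T*`, with
frame `e^i`, anchor `P̃`, and `[e^i, e^j]` the Koszul bracket of 1-forms. -/
def koszulModel (P : Model n → CoModel n [⋀^Fin 2]→L[ℝ] ℝ) {p q m : ℕ} (h : p + q = m + 1)
    (α : Model n → Model n [⋀^Fin p]→L[ℝ] ℝ) (β : Model n → Model n [⋀^Fin q]→L[ℝ] ℝ) :
    Model n → Model n [⋀^Fin m]→L[ℝ] ℝ :=
  schoutenFrame basisVec (fun i y => sharp (P y) (basisCovec i))
    (fun i j => koszulOneForms P (fun _ => ofFunctional (basisCovec i))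
      (fun _ => ofFunctional (basisCovec j))) h α β

/-! ### Manifolds -/

section Manifold

variable {M : Type*} [TopologicalSpace M] [ChartedSpace (Model n) M]

variable (n M) in
/-- Differential `k`-forms on the `n`-manifold `M`, not necessarily smooth. -/
abbrev DiffForm (k : ℕ) : Type _ := ∀ x : M, TangentSpace (𝓡 n) x [⋀^Fin k]→L[ℝ] ℝ

variable (n M) in
/-- Multivector fields of degree `k` on `M`, not necessarily smooth: alternating `k`-linear forms
on the cotangent spaces. -/
abbrev MultivectorField (k : ℕ) : Type _ :=
  ∀ x : M, (TangentSpace (𝓡 n) x →L[ℝ] ℝ) [⋀^Fin k]→L[ℝ] ℝ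

/-- The differential at `x` of the chart around `x₀`. -/
def chartDiff (x₀ x : M) : TangentSpace (𝓡 n) x →L[ℝ] Model n :=
  mfderiv (𝓡 n) (𝓡 n) (chartAt (Model n) x₀) x

/-- The differential at `y` of the inverse of the chart around `x₀`. -/
def chartSymmDiff (x₀ : M) (y : Model n) :
    Model n →L[ℝ] TangentSpace (𝓡 n) ((chartAt (Model n) x₀).symm y) :=
  mfderiv (𝓡 n) (𝓡 n) (chartAt (Model n) x₀).symm y

/-- The expression of a form in the chart around `x₀`. -/
def formInChart {k : ℕ} (α : DiffForm n M k) (x₀ : M) (y : Model n) :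
    Model n [⋀^Fin k]→L[ℝ] ℝ :=
  (α ((chartAt (Model n) x₀).symm y)).compContinuousLinearMap (chartSymmDiff x₀ y)

/-- The form on the tangent space at `x` which has the expression `η` in the chart around `x`. -/
def formFromChart {k : ℕ} (x : M) (η : Model n [⋀^Fin k]→L[ℝ] ℝ) :
    TangentSpace (𝓡 n) x [⋀^Fin k]→L[ℝ] ℝ :=
  η.compContinuousLinearMap (chartDiff x x)

/-- The expression of a multivector field in the chart around `x₀`. -/
def multivectorInChart {k : ℕ} (S : MultivectorField n M k) (x₀ : M) (y : Model n) :
    CoModel n [⋀^Fin k]→L[ℝ] ℝ :=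
  (S ((chartAt (Model n) x₀).symm y)).compContinuousLinearMap
    (ContinuousLinearMap.precomp ℝ (chartDiff x₀ ((chartAt (Model n) x₀).symm y)))

/-- The multivector at `x` which has the expression `Q` in the chart around `x`. -/
def multivectorFromChart {k : ℕ} (x : M) (Q : CoModel n [⋀^Fin k]→L[ℝ] ℝ) :
    (TangentSpace (𝓡 n) x →L[ℝ] ℝ) [⋀^Fin k]→L[ℝ] ℝ :=
  Q.compContinuousLinearMap
    (ContinuousLinearMap.precomp ℝ
      (show Model n →L[ℝ] TangentSpace (𝓡 n) x from
        mfderiv (𝓡 n) (𝓡 n) (chartAt (Model n) x).symm (chartAt (Model n) x x)))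

/-- Smoothness of a form: its expressions in the charts are smooth. -/
def IsSmoothForm {k : ℕ} (α : DiffForm n M k) : Prop :=
  ∀ x₀ : M, ContDiffOn ℝ ∞ (formInChart α x₀) (chartAt (Model n) x₀).target

/-- Smoothness of a multivector field: its expressions in the charts are smooth. -/
def IsSmoothMultivectorField {k : ℕ} (S : MultivectorField n M k) : Prop :=
  ∀ x₀ : M, ContDiffOn ℝ ∞ (multivectorInChart S x₀) (chartAt (Model n) x₀).target

/-- The exterior derivative on `M`. -/
def extD {k : ℕ} (α : DiffForm n M k) : DiffForm n M (k + 1) := fun x =>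
  formFromChart x (extDeriv (formInChart α x) (chartAt (Model n) x x))

/-- The Schouten bracket of multivector fields on `M`. -/
def schouten {p q m : ℕ} (h : p + q = m + 1) (S : MultivectorField n M p)
    (Q : MultivectorField n M q) : MultivectorField n M m := fun x =>
  multivectorFromChart x
    (schoutenModel h (multivectorInChart S x) (multivectorInChart Q x) (chartAt (Model n) x x))

/-- The Koszul bracket `[α, β]_π` of differential forms on `M`. -/
def koszul (π : MultivectorField n M 2) {p q m : ℕ} (h : p + q = m + 1) (α : DiffForm n M p)
    (β : DiffForm n M q) : DiffForm n M m := fun x =>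
  formFromChart x
    (koszulModel (multivectorInChart π x) h (formInChart α x) (formInChart β x)
      (chartAt (Model n) x x))

/-- A Poisson structure: a smooth bivector field `π` with `[π, π] = 0`. -/
def IsPoisson (π : MultivectorField n M 2) : Prop :=
  IsSmoothMultivectorField π ∧ schouten (show 2 + 2 = 3 + 1 from rfl) π π = 0

/-- `T(π, Ω) = 1 + π̃ Ω̃` at `x`. -/
def twistAt (π : MultivectorField n M 2) (Ω : DiffForm n M 2) (x : M) :
    Model n →L[ℝ] Model n :=
  twistOp (π x) (Ω x)

/-- `τ_π Ω`, the 2-form whose associated map is `Ω̃ T(π, Ω)⁻¹`. -/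
def tauForm (π : MultivectorField n M 2) (Ω : DiffForm n M 2)
    (h : ∀ x : M, IsUnit (twistAt π Ω x)) : DiffForm n M 2 := fun x =>
  tau (π x) (Ω x) (h x)

end Manifold

end PoissonGauge

end

/-! In a chart, let `P` and `w` be the expressions of the bivector and the closed form, T = 1 -
P̃w̃, and let η be the transformed form. The only fact used about η is the relation η̃T = w̃, which
avoids differentiating an inverse. Differentiating it along a, pairing with Tc and using η(V, Tc) =
-w(c, V), the terms containing P and ∂w together cancel and leave (∂_a η)(Tb, Tc) = (∂_a w)(b, c) -
(∂_a P)(w̃b, w̃c) (`flat_fderiv_twistOp`).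

Since T is invertible, the Maurer-Cartan equation may be tested on Ta, Tb, Tc. By
`koszulModel_self_apply`, half the Koszul bracket is the cyclic sum of (∂_{P̃w̃a} η)(Tb, Tc) +
(∂_{Ta} P)(w̃b, w̃c), because η̃T = w̃. As Ta + P̃w̃a = a, adding dη turns the derivatives of η into
the cyclic sum of (∂_a η)(Tb, Tc). Inserting the formula above, the terms ∂_a P cancel, and what
remains is dw(a, b, c) - ½[P, P](w̃a, w̃b, w̃c), which is zero because w is closed and P is Poisson
(`extDeriv_add_half_koszulModel`).

Smoothness holds since η̃ = w̃T⁻¹ and inversion is smooth on units. On the manifold, chart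
differentials conjugate T, so the relation η̃T = w̃ holds in every chart (`flat_tauForm_inChart`).
-/

noncomputable section

namespace PoissonGauge

/-! ### Alternating forms of degree at most three -/

section Algebra

variable {W : Type*} [NormedAddCommGroup W] [NormedSpace ℝ W]

theorem sum_perm_fin_three (f : Equiv.Perm (Fin 3) → ℝ) :
    ∑ σ, f σ = f 1 + f (Equiv.swap 0 1) + f (Equiv.swap 0 2) + f (Equiv.swap 1 2)
      + f (Equiv.swap 0 1 * Equiv.swap 1 2) + f (Equiv.swap 1 2 * Equiv.swap 0 1) := by
  have h : (Finset.univ : Finset (Equiv.Perm (Fin 3))) =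
      {1, Equiv.swap 0 1, Equiv.swap 0 2, Equiv.swap 1 2,
        Equiv.swap 0 1 * Equiv.swap 1 2, Equiv.swap 1 2 * Equiv.swap 0 1} := by decide
  rw [h, Finset.sum_insert (by decide), Finset.sum_insert (by decide),
    Finset.sum_insert (by decide), Finset.sum_insert (by decide), Finset.sum_insert (by decide),
    Finset.sum_singleton]
  ring

theorem sum_perm_fin_two (f : Equiv.Perm (Fin 2) → ℝ) :
    ∑ σ, f σ = f 1 + f (Equiv.swap 0 1) := by
  have h : (Finset.univ : Finset (Equiv.Perm (Fin 2))) = {1, Equiv.swap 0 1} := by decide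
  rw [h, Finset.sum_insert (by decide), Finset.sum_singleton]

theorem map_vec_swap (w : W [⋀^Fin 2]→L[ℝ] ℝ) (X Y : W) : w ![X, Y] = -w ![Y, X] := by
  have h := w.map_swap ![Y, X] (i := 0) (j := 1) (by decide)
  refine Eq.trans ?_ h
  change w ![X, Y] = w _
  congr 1
  ext i
  fin_cases i <;> rfl

theorem flat_swap (w : W [⋀^Fin 2]→L[ℝ] ℝ) (X Y : W) : flat w X Y = -flat w Y X := by
  rw [flat_apply, flat_apply, map_vec_swap]

theorem ext_vec_two {v w : W [⋀^Fin 2]→L[ℝ] ℝ} (h : ∀ X Y, v ![X, Y] = w ![X, Y]) : v = w := by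
  ext u
  have hu : u = ![u 0, u 1] := by
    ext i
    fin_cases i <;> rfl
  rw [hu, h]

theorem ext_vec_three {v w : W [⋀^Fin 3]→L[ℝ] ℝ} (h : ∀ X Y Z, v ![X, Y, Z] = w ![X, Y, Z]) :
    v = w := by
  ext u
  have hu : u = ![u 0, u 1, u 2] := by
    ext i
    fin_cases i <;> rfl
  rw [hu, h]

theorem flat_injective : Function.Injective (flat (W := W)) := by
  intro v w h
  exact ext_vec_two fun X Y => by rw [← flat_apply, ← flat_apply, h]

theorem comp_vec_one (a : W [⋀^Fin 1]→L[ℝ] ℝ) (v : Fin 1 → W) : a v = toFunctional a (v 0) := by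
  change a v = a (fun _ => v 0)
  congr 1
  ext i
  fin_cases i
  rfl

theorem comp_vec_two (b : W [⋀^Fin 2]→L[ℝ] ℝ) (v : Fin 2 → W) : b v = flat b (v 0) (v 1) := by
  rw [flat_apply]
  congr 1
  ext i
  fin_cases i <;> rfl

theorem toFunctional_curryLeft (w : W [⋀^Fin 2]→L[ℝ] ℝ) (X : W) :
    toFunctional (w.curryLeft X) = flat w X := rfl

theorem wedge_one_one_apply (a b : W [⋀^Fin 1]→L[ℝ] ℝ) (v : Fin 2 → W) :
    wedge (show 1 + 1 = 2 from rfl) a b v =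
      toFunctional a (v 0) * toFunctional b (v 1) - toFunctional a (v 1) * toFunctional b (v 0) := by
  rw [wedge_apply, sum_perm_fin_two]
  simp only [comp_vec_one]
  simp [Fin.cast, Fin.natAdd, Fin.castAdd]
  ring

/-- The six permutations pair off under exchanging the two arguments of `b`; the resulting factor 2
cancels the normalisation 1!2!. -/
theorem wedge_one_two_apply (a : W [⋀^Fin 1]→L[ℝ] ℝ) (b : W [⋀^Fin 2]→L[ℝ] ℝ) (X Y Z : W) :
    wedge (show 1 + 2 = 3 from rfl) a b ![X, Y, Z] =
      toFunctional a X * flat b Y Z + toFunctional a Y * flat b Z X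
        + toFunctional a Z * flat b X Y := by
  rw [wedge_apply, sum_perm_fin_three]
  simp only [comp_vec_one, comp_vec_two]
  simp [Fin.cast, Fin.natAdd, Fin.castAdd, Equiv.swap_apply_def, Equiv.Perm.sign_swap']
  rw [flat_swap b X Z, flat_swap b Z Y, flat_swap b Y X]
  ring

theorem wedge_two_one_apply (b : W [⋀^Fin 2]→L[ℝ] ℝ) (a : W [⋀^Fin 1]→L[ℝ] ℝ) (X Y Z : W) :
    wedge (show 2 + 1 = 3 from rfl) b a ![X, Y, Z] =
      toFunctional a X * flat b Y Z + toFunctional a Y * flat b Z X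
        + toFunctional a Z * flat b X Y := by
  rw [wedge_apply, sum_perm_fin_three]
  simp only [comp_vec_one, comp_vec_two]
  simp [Fin.cast, Fin.natAdd, Fin.castAdd, Equiv.swap_apply_def, Equiv.Perm.sign_swap']
  rw [flat_swap b X Z, flat_swap b Z Y, flat_swap b Y X]
  ring

/-- `flat` as a continuous linear map. -/
def flatL : (W [⋀^Fin 2]→L[ℝ] ℝ) →L[ℝ] W →L[ℝ] W →L[ℝ] ℝ :=
  (ContinuousLinearMap.compL ℝ W (W [⋀^Fin 1]→L[ℝ] ℝ) (W →L[ℝ] ℝ)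
    ((ContinuousAlternatingMap.ofSubsingletonLIE (𝕜 := ℝ) (E := W) (F := ℝ)
      (0 : Fin 1)).symm.toContinuousLinearEquiv)).comp
    (ContinuousAlternatingMap.curryLeftLI (𝕜 := ℝ) (E := W) (F := ℝ)).toContinuousLinearMap

theorem flatL_apply (w : W [⋀^Fin 2]→L[ℝ] ℝ) : flatL w = flat w := rfl

/-- A continuous linear left inverse of `flat`. -/
def unflatL : (W →L[ℝ] W →L[ℝ] ℝ) →L[ℝ] W [⋀^Fin 2]→L[ℝ] ℝ :=
  (1 / 2 : ℝ) • (ContinuousAlternatingMap.alternatizeUncurryFinCLM ℝ W ℝ).comp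
    (ContinuousLinearMap.compL ℝ W (W →L[ℝ] ℝ) (W [⋀^Fin 1]→L[ℝ] ℝ)
      ((ContinuousAlternatingMap.ofSubsingletonLIE (𝕜 := ℝ) (E := W) (F := ℝ)
        (0 : Fin 1)).toContinuousLinearEquiv))

/-- Alternating a form that is already alternating doubles it, hence the factor 1/2. This recovers a
form smoothly from its associated map. -/
theorem unflatL_flat (w : W [⋀^Fin 2]→L[ℝ] ℝ) : unflatL (flat w) = w := by
  refine ext_vec_two fun X Y => ?_
  have h : unflatL (flat w) ![X, Y] = 1 / 2 * (flat w X Y - flat w Y X) := by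
    simp only [unflatL, smul_apply, ContinuousLinearMap.comp_apply,
      ContinuousAlternatingMap.smul_apply, smul_eq_mul]
    congr 1
    refine (ContinuousAlternatingMap.alternatizeUncurryFin_apply _ _).trans ?_
    rw [Fin.sum_univ_two]
    simp [ContinuousAlternatingMap.ofSubsingletonLIE, Fin.removeNth, sub_eq_add_neg]
  rw [h, flat_swap w Y X, ← flat_apply]
  ring

end Algebra

/-! ### Coordinate formulas for d, the Schouten bracket and the Koszul bracket -/

variable {n : ℕ}

/-- The identification of the bidual of the model space with the model space. -/
def bidualToModel : (CoModel n →L[ℝ] ℝ) →L[ℝ] Model n :=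
  ∑ i, (ContinuousLinearMap.apply ℝ ℝ (basisCovec i)).smulRight (basisVec i)

/-- `sharp` as a continuous linear map. -/
def sharpL : (CoModel n [⋀^Fin 2]→L[ℝ] ℝ) →L[ℝ] (CoModel n →L[ℝ] Model n) :=
  (ContinuousLinearMap.compL ℝ (CoModel n) (CoModel n →L[ℝ] ℝ) (Model n) bidualToModel).comp flatL

theorem sharpL_apply (P : CoModel n [⋀^Fin 2]→L[ℝ] ℝ) : sharpL P = sharp P := by
  ext a
  simp [sharpL, sharp, bidualToModel, flatL_apply]

theorem apply_sharp_eq_flat (P : CoModel n [⋀^Fin 2]→L[ℝ] ℝ) (a b : CoModel n) :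
    b (sharp P a) = flat P a b := by
  rw [sharp_apply, flat_apply]

theorem model_ext {X Y : Model n} (h : ∀ b : CoModel n, b X = b Y) : X = Y := by
  ext j
  exact h (basisCovec j)

theorem sharp_neg (P : CoModel n [⋀^Fin 2]→L[ℝ] ℝ) : sharp (-P) = -sharp P := by
  ext1 a
  refine model_ext fun b => ?_
  rw [neg_apply, map_neg, sharp_apply, sharp_apply]
  rfl

theorem sum_apply_basisVec_smul (a : CoModel n) : ∑ i, a (basisVec i) • basisCovec i = a := by
  ext x
  have hx : x = ∑ i, x i • basisVec i := by
    ext j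
    simp [basisVec, Pi.single_apply]
  conv_rhs => rw [hx]
  simp [basisCovec, mul_comm]

theorem sum_basisCovec_smul (X : Model n) : ∑ i, basisCovec i X • basisVec i = X := by
  ext j
  simp [basisVec, basisCovec, Pi.single_apply]

theorem extDeriv_vec_three {V : Type*} [NormedAddCommGroup V] [NormedSpace ℝ V]
    (η : V → V [⋀^Fin 2]→L[ℝ] ℝ) (y X Y Z : V) :
    extDeriv η y ![X, Y, Z] = flat (fderiv ℝ η y X) Y Z + flat (fderiv ℝ η y Y) Z X
      + flat (fderiv ℝ η y Z) X Y := by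
  refine (ContinuousAlternatingMap.alternatizeUncurryFin_apply _ _).trans ?_
  rw [Fin.sum_univ_three]
  simp only [comp_vec_two]
  simp [Fin.removeNth, Fin.succAbove]
  rw [flat_swap _ X Z, neg_neg]

/-- The coordinate forms are closed, so the two Lie derivatives are dPⁱʲ and dPʲⁱ = -dPⁱʲ; hence
[eⁱ, eʲ] = 2dPⁱʲ - dPⁱʲ = dPⁱʲ. -/
theorem koszulOneForms_basisCovec (P : Model n → CoModel n [⋀^Fin 2]→L[ℝ] ℝ) (i j : Fin n)
    {y : Model n} (hP : DifferentiableAt ℝ P y) (X : Model n) :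
    toFunctional (koszulOneForms P (fun _ => ofFunctional (basisCovec i))
      (fun _ => ofFunctional (basisCovec j)) y) X =
      flat (fderiv ℝ P y X) (basisCovec i) (basisCovec j) := by
  have hlie : ∀ (V : Model n → Model n) (b : CoModel n),
      lieDeriv V (fun _ => ofFunctional b) y = ofFunctional (fderiv ℝ (fun z => b (V z)) y) := by
    intro V b
    have h1 : extDeriv (fun _ : Model n => ofFunctional b) y = 0 := by
      have hc : fderiv ℝ (fun _ : Model n => ofFunctional b) y = 0 :=
        (hasFDerivAt_const (ofFunctional b) y).fderiv
      rw [extDeriv, hc]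
      exact map_zero (ContinuousAlternatingMap.alternatizeUncurryFinCLM ℝ (Model n) ℝ)
    have h2 := extDeriv_constOfIsEmpty (𝕜 := ℝ) (fun z => b (V z)) y
    have h3 : (fun z => (ofFunctional b).curryLeft (V z)) =
        fun z => ContinuousAlternatingMap.constOfIsEmpty ℝ (Model n) (Fin 0) (b (V z)) := by
      funext z
      ext v
      rfl
    simp only [lieDeriv]
    rw [h1, h3, h2]
    ext v
    simp [ofFunctional]
  have hd : ∀ a b : CoModel n, fderiv ℝ (fun z => P z ![a, b]) y X =
      flat (fderiv ℝ P y X) a b := by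
    intro a b
    have h := hP.hasFDerivAt.continuousAlternatingMap_apply_const ![a, b]
    rw [h.fderiv, flat_apply]
    rfl
  have h4 : extDeriv (fun z => ofScalar (P z ![basisCovec i, basisCovec j])) y =
      ofFunctional (fderiv ℝ (fun z => P z ![basisCovec i, basisCovec j]) y) :=
    extDeriv_constOfIsEmpty (fun z => P z ![basisCovec i, basisCovec j]) y
  have ht : ∀ a : CoModel n, toFunctional (ofFunctional a) = a := fun a => rfl
  simp only [koszulOneForms, ht]
  rw [hlie, hlie, h4]
  simp only [sharp_apply]
  change fderiv ℝ (fun z => P z ![basisCovec i, basisCovec j]) y X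
    - fderiv ℝ (fun z => P z ![basisCovec j, basisCovec i]) y X
    - fderiv ℝ (fun z => P z ![basisCovec i, basisCovec j]) y X = _
  rw [hd, hd, flat_swap _ (basisCovec j)]
  ring

/-- The derivative of a field along a vector expanded in the standard basis. -/
theorem sum_mul_flat_fderiv {W : Type*} [NormedAddCommGroup W] [NormedSpace ℝ W]
    (L : Model n →L[ℝ] W [⋀^Fin 2]→L[ℝ] ℝ) {ι : Type*} [Fintype ι] (r : ι → ℝ)
    (V : ι → Model n) (X Y : W) :
    ∑ i, r i * flat (L (V i)) X Y = flat (L (∑ i, r i • V i)) X Y := by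
  simp only [flat_apply, map_sum, map_smul]
  simp [ContinuousAlternatingMap.sum_apply]

theorem sum_flat_mul_flat_fderiv {W : Type*} [NormedAddCommGroup W] [NormedSpace ℝ W]
    (L : Model n →L[ℝ] W [⋀^Fin 2]→L[ℝ] ℝ) (P : CoModel n [⋀^Fin 2]→L[ℝ] ℝ) (a : CoModel n)
    (X Y : W) :
    ∑ i, flat P (basisCovec i) a * flat (L (basisVec i)) X Y = -flat (L (sharp P a)) X Y := by
  rw [sum_mul_flat_fderiv]
  have h : ∑ i, flat P (basisCovec i) a • basisVec i = -sharp P a := by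
    simp only [flat_swap P _ a, neg_smul, Finset.sum_neg_distrib, ← apply_sharp_eq_flat]
    rw [sum_basisCovec_smul]
  rw [h, map_neg, flat_apply, flat_apply]
  rfl

/-- The coordinate frame commutes, so only derivative terms survive. A 1-form and a 2-form commute
under the wedge, so the two families of terms agree, whence the factor 2. The sign in P̃a = -∑ P(eⁱ,
a) e_i absorbs the remaining minus. -/
theorem schoutenModel_self_apply (P : Model n → CoModel n [⋀^Fin 2]→L[ℝ] ℝ) (y : Model n)
    (a b c : CoModel n) :
    schoutenModel (show 2 + 2 = 3 + 1 from rfl) P P y ![a, b, c] =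
      2 * (flat (fderiv ℝ P y (sharp (P y) a)) b c + flat (fderiv ℝ P y (sharp (P y) b)) c a
        + flat (fderiv ℝ P y (sharp (P y) c)) a b) := by
  have h0 : schoutenModel (show 2 + 2 = 3 + 1 from rfl) P P y =
      ∑ i, ((-1 : ℝ) ^ 1 • wedge (show 1 + 2 = 3 from rfl) ((P y).curryLeft (basisCovec i))
          (fderiv ℝ P y (basisVec i))
        - wedge (show 2 + 1 = 3 from rfl) (fderiv ℝ P y (basisVec i))
          ((P y).curryLeft (basisCovec i)))
      + ∑ i, ∑ j, (-1 : ℝ) ^ 1 • wedge (show 2 + 1 = 3 from rfl)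
          (wedge (show 1 + 1 = 2 from rfl) ((P y).curryLeft (basisCovec i)) 0)
          ((P y).curryLeft (basisCovec j)) := rfl
  have h1 : ∀ X : CoModel n, wedge (show 1 + 1 = 2 from rfl) ((P y).curryLeft X)
      (0 : CoModel n [⋀^Fin 1]→L[ℝ] ℝ) = 0 := by
    intro X
    ext v
    rw [wedge_one_one_apply]
    simp [toFunctional]
  have h2 : ∀ X : CoModel n, wedge (show 2 + 1 = 3 from rfl) (0 : CoModel n [⋀^Fin 2]→L[ℝ] ℝ)
      ((P y).curryLeft X) = 0 := by
    intro X
    refine ext_vec_three fun a b c => ?_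
    rw [wedge_two_one_apply]
    simp [flat_apply]
  rw [h0]
  simp only [h1, h2, smul_zero, Finset.sum_const_zero, add_zero]
  rw [ContinuousAlternatingMap.sum_apply]
  simp only [ContinuousAlternatingMap.sub_apply, ContinuousAlternatingMap.smul_apply,
    wedge_one_two_apply, wedge_two_one_apply, toFunctional_curryLeft, smul_eq_mul]
  have e1 := sum_flat_mul_flat_fderiv (fderiv ℝ P y) (P y) a b c
  have e2 := sum_flat_mul_flat_fderiv (fderiv ℝ P y) (P y) b c a
  have e3 := sum_flat_mul_flat_fderiv (fderiv ℝ P y) (P y) c a b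
  rw [← neg_eq_iff_eq_neg] at e1 e2 e3
  rw [← e1, ← e2, ← e3, ← Finset.sum_neg_distrib, ← Finset.sum_neg_distrib,
    ← Finset.sum_neg_distrib, ← Finset.sum_add_distrib, ← Finset.sum_add_distrib, Finset.mul_sum]
  refine Finset.sum_congr rfl fun i _ => ?_
  ring

theorem sum_flat_mul_flat_sharp (L : Model n →L[ℝ] Model n [⋀^Fin 2]→L[ℝ] ℝ)
    (P : CoModel n [⋀^Fin 2]→L[ℝ] ℝ) (w : Model n [⋀^Fin 2]→L[ℝ] ℝ) (X Y Z : Model n) :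
    ∑ i, flat w (basisVec i) X * flat (L (sharp P (basisCovec i))) Y Z =
      -flat (L (sharp P (flat w X))) Y Z := by
  rw [sum_mul_flat_fderiv]
  have h : ∑ i, flat w (basisVec i) X • sharp P (basisCovec i) = -sharp P (flat w X) := by
    simp only [flat_swap w _ X, neg_smul, Finset.sum_neg_distrib]
    simp only [← map_smul, ← map_sum]
    rw [sum_apply_basisVec_smul]
  rw [h, map_neg, flat_apply, flat_apply]
  rfl

theorem sum_flat_mul_flat_mul_flat (w : Model n [⋀^Fin 2]→L[ℝ] ℝ)
    (Q : CoModel n [⋀^Fin 2]→L[ℝ] ℝ) (X Y : Model n) :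
    ∑ i, ∑ j, flat w (basisVec i) X * flat w (basisVec j) Y *
        flat Q (basisCovec i) (basisCovec j) = flat Q (flat w X) (flat w Y) := by
  conv_rhs => rw [← sum_apply_basisVec_smul (flat w X), ← sum_apply_basisVec_smul (flat w Y)]
  simp only [flat_swap w _ X, flat_swap w _ Y, map_sum, map_smul, sum_apply, smul_apply,
    smul_eq_mul, Finset.mul_sum]
  rw [Finset.sum_comm]
  refine Finset.sum_congr rfl fun i _ => Finset.sum_congr rfl fun j _ => ?_
  ring

theorem flat_wedge_one_one {W : Type*} [NormedAddCommGroup W] [NormedSpace ℝ W]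
    (a b : W [⋀^Fin 1]→L[ℝ] ℝ) (X Y : W) :
    flat (wedge (show 1 + 1 = 2 from rfl) a b) X Y =
      toFunctional a X * toFunctional b Y - toFunctional a Y * toFunctional b X := by
  rw [flat_apply, wedge_one_one_apply]
  rfl

/-- The derivative terms combine as for the Schouten bracket, with P̃eⁱ as anchor. The structure
functions ∂P(eⁱ, eʲ), contracted with η twice, give ∂P(η̃·, η̃·); antisymmetry identifies the two
orders and gives the second factor 2. -/
theorem koszulModel_self_apply (P : Model n → CoModel n [⋀^Fin 2]→L[ℝ] ℝ)
    (η : Model n → Model n [⋀^Fin 2]→L[ℝ] ℝ) {y : Model n} (hP : DifferentiableAt ℝ P y)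
    (X Y Z : Model n) :
    koszulModel P (show 2 + 2 = 3 + 1 from rfl) η η y ![X, Y, Z] =
      2 * (flat (fderiv ℝ η y (sharp (P y) (flat (η y) X))) Y Z
          + flat (fderiv ℝ η y (sharp (P y) (flat (η y) Y))) Z X
          + flat (fderiv ℝ η y (sharp (P y) (flat (η y) Z))) X Y)
      + 2 * (flat (fderiv ℝ P y X) (flat (η y) Y) (flat (η y) Z)
          + flat (fderiv ℝ P y Y) (flat (η y) Z) (flat (η y) X)
          + flat (fderiv ℝ P y Z) (flat (η y) X) (flat (η y) Y)) := by
  have h0 : koszulModel P (show 2 + 2 = 3 + 1 from rfl) η η y =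
      ∑ i, ((-1 : ℝ) ^ 1 • wedge (show 1 + 2 = 3 from rfl) ((η y).curryLeft (basisVec i))
          (fderiv ℝ η y (sharp (P y) (basisCovec i)))
        - wedge (show 2 + 1 = 3 from rfl) (fderiv ℝ η y (sharp (P y) (basisCovec i)))
          ((η y).curryLeft (basisVec i)))
      + ∑ i, ∑ j, (-1 : ℝ) ^ 1 • wedge (show 2 + 1 = 3 from rfl)
          (wedge (show 1 + 1 = 2 from rfl) ((η y).curryLeft (basisVec i))
            (koszulOneForms P (fun _ => ofFunctional (basisCovec i))
              (fun _ => ofFunctional (basisCovec j)) y))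
          ((η y).curryLeft (basisVec j)) := rfl
  rw [h0, ContinuousAlternatingMap.add_apply]
  simp only [ContinuousAlternatingMap.sum_apply, ContinuousAlternatingMap.sub_apply,
    ContinuousAlternatingMap.smul_apply, wedge_one_two_apply, wedge_two_one_apply,
    flat_wedge_one_one, koszulOneForms_basisCovec P _ _ hP, toFunctional_curryLeft, smul_eq_mul]
  congr 1
  · have e1 := sum_flat_mul_flat_sharp (fderiv ℝ η y) (P y) (η y) X Y Z
    have e2 := sum_flat_mul_flat_sharp (fderiv ℝ η y) (P y) (η y) Y Z X
    have e3 := sum_flat_mul_flat_sharp (fderiv ℝ η y) (P y) (η y) Z X Y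
    rw [← neg_eq_iff_eq_neg] at e1 e2 e3
    rw [← e1, ← e2, ← e3, ← Finset.sum_neg_distrib, ← Finset.sum_neg_distrib,
      ← Finset.sum_neg_distrib, ← Finset.sum_add_distrib, ← Finset.sum_add_distrib,
      Finset.mul_sum]
    refine Finset.sum_congr rfl fun i _ => ?_
    ring
  -- Here `D i j V` stands for (∂_V P)(eⁱ, eʲ); the regrouping is purely algebraic and uses no
  -- antisymmetry.
  · have hsum : ∀ D : Fin n → Fin n → Model n → ℝ,
        (∑ i, ∑ j, (-1 : ℝ) ^ 1 *
          (flat (η y) (basisVec j) X * (flat (η y) (basisVec i) Y * D i j Z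
              - flat (η y) (basisVec i) Z * D i j Y)
            + flat (η y) (basisVec j) Y * (flat (η y) (basisVec i) Z * D i j X
              - flat (η y) (basisVec i) X * D i j Z)
            + flat (η y) (basisVec j) Z * (flat (η y) (basisVec i) X * D i j Y
              - flat (η y) (basisVec i) Y * D i j X))) =
        (∑ i, ∑ j, flat (η y) (basisVec i) Y * flat (η y) (basisVec j) Z * D i j X)
        - (∑ i, ∑ j, flat (η y) (basisVec i) Z * flat (η y) (basisVec j) Y * D i j X)
        + (∑ i, ∑ j, flat (η y) (basisVec i) Z * flat (η y) (basisVec j) X * D i j Y)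
        - (∑ i, ∑ j, flat (η y) (basisVec i) X * flat (η y) (basisVec j) Z * D i j Y)
        + (∑ i, ∑ j, flat (η y) (basisVec i) X * flat (η y) (basisVec j) Y * D i j Z)
        - (∑ i, ∑ j, flat (η y) (basisVec i) Y * flat (η y) (basisVec j) X * D i j Z) := by
      intro D
      simp only [← Finset.sum_add_distrib, ← Finset.sum_sub_distrib]
      refine Finset.sum_congr rfl fun i _ => Finset.sum_congr rfl fun j _ => ?_
      ring
    rw [hsum fun i j V => flat (fderiv ℝ P y V) (basisCovec i) (basisCovec j)]
    simp only [sum_flat_mul_flat_mul_flat]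
    rw [flat_swap _ (flat (η y) Z) (flat (η y) Y), flat_swap _ (flat (η y) X) (flat (η y) Z),
      flat_swap _ (flat (η y) Y) (flat (η y) X)]
    ring

/-! ### The differentiated gauge relation and the pointwise Maurer-Cartan equation -/

theorem hasFDerivAt_clm_comp {V E F : Type*} [NormedAddCommGroup V] [NormedSpace ℝ V]
    [NormedAddCommGroup E] [NormedSpace ℝ E] [NormedAddCommGroup F] [NormedSpace ℝ F]
    {f : V → E} {y : V} (hf : DifferentiableAt ℝ f y) (L : E →L[ℝ] F) :
    HasFDerivAt (fun z => L (f z)) (L.comp (fderiv ℝ f y)) y :=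
  L.hasFDerivAt.comp y hf.hasFDerivAt

theorem hasFDerivAt_flat_comp {w : Model n → Model n [⋀^Fin 2]→L[ℝ] ℝ} {y : Model n}
    (hw : DifferentiableAt ℝ w y) :
    HasFDerivAt (fun z => flat (w z)) (flatL.comp (fderiv ℝ w y)) y :=
  hasFDerivAt_clm_comp (F := Model n →L[ℝ] Model n →L[ℝ] ℝ) hw flatL

theorem hasFDerivAt_sharp_comp {P : Model n → CoModel n [⋀^Fin 2]→L[ℝ] ℝ} {y : Model n}
    (hP : DifferentiableAt ℝ P y) :
    HasFDerivAt (fun z => sharp (P z)) (sharpL.comp (fderiv ℝ P y)) y := by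
  simp only [← sharpL_apply]
  exact hasFDerivAt_clm_comp (E := CoModel n [⋀^Fin 2]→L[ℝ] ℝ) (F := CoModel n →L[ℝ] Model n)
    hP sharpL

theorem contDiff_sharpL : ContDiff ℝ ∞ (sharpL (n := n)) :=
  ContinuousLinearMap.contDiff (𝕜 := ℝ) _

theorem contDiff_flatL : ContDiff ℝ ∞ (flatL (W := Model n)) :=
  ContinuousLinearMap.contDiff (𝕜 := ℝ) _

theorem contDiff_unflatL : ContDiff ℝ ∞ (unflatL (W := Model n)) :=
  ContinuousLinearMap.contDiff (𝕜 := ℝ) _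

theorem twistOp_neg_apply (P : CoModel n [⋀^Fin 2]→L[ℝ] ℝ) (w : Model n [⋀^Fin 2]→L[ℝ] ℝ)
    (X : Model n) : twistOp (-P) w X = X - sharp P (flat w X) := by
  rw [twistOp, sharp_neg, sub_eq_add_neg]
  rfl

/-- The derivative of a solution `η` of `η̃ (1 - P̃ w̃) = w̃`. -/
theorem flat_fderiv_twistOp {P : Model n → CoModel n [⋀^Fin 2]→L[ℝ] ℝ}
    {w η : Model n → Model n [⋀^Fin 2]→L[ℝ] ℝ} {y : Model n} (hP : DifferentiableAt ℝ P y)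
    (hw : DifferentiableAt ℝ w y) (hη : DifferentiableAt ℝ η y)
    (h : ∀ᶠ z in nhds y, ∀ X, flat (η z) (twistOp (-P z) (w z) X) = flat (w z) X)
    (a b c : Model n) :
    flat (fderiv ℝ η y a) (twistOp (-P y) (w y) b) (twistOp (-P y) (w y) c) =
      flat (fderiv ℝ w y a) b c - flat (fderiv ℝ P y a) (flat (w y) b) (flat (w y) c) := by
  have hP' := hasFDerivAt_sharp_comp hP
  have hw' := (hasFDerivAt_flat_comp hw).clm_apply (hasFDerivAt_const b y)
  have hη' := hasFDerivAt_flat_comp hη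
  have hf := hη'.clm_apply ((hasFDerivAt_const b y).sub (hP'.clm_apply hw'))
  -- Both sides of η̃(Tb) = w̃b agree near y, so the product-rule derivative of the left side equals
  -- the derivative of the right.
  have heq := hf.unique (hw'.congr_of_eventuallyEq (by
    filter_upwards [h] with z hz
    have h1 := hz b
    rw [twistOp_neg_apply] at h1
    simpa [sharpL_apply, flatL_apply] using h1))
  have h2 := congrArg (fun L => L a (twistOp (-P y) (w y) c)) heq
  simp only [add_apply, ContinuousLinearMap.comp_apply, ContinuousLinearMap.flip_apply,
    zero_apply, map_zero, Pi.sub_apply, zero_sub, map_neg, neg_apply, zero_add, sharpL_apply, flatL_apply, map_add, neg_add] at h2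
  -- Antisymmetry moves T into the first slot of η, where η̃T = w̃ removes η altogether.
  have hη0 : ∀ V, flat (η y) V (twistOp (-P y) (w y) c) = -flat (w y) c V := by
    intro V
    rw [flat_swap, h.self_of_nhds c]
  rw [hη0, hη0, apply_sharp_eq_flat, apply_sharp_eq_flat] at h2
  rw [twistOp_neg_apply _ _ b]
  -- The extra term P((∂_a w)~b, w̃c) cancels the one produced by differentiating w inside T.
  have h3 : flat (fderiv ℝ w y a) b (twistOp (-P y) (w y) c) =
      flat (fderiv ℝ w y a) b c + flat (P y) (flat (fderiv ℝ w y a) b) (flat (w y) c) := by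
    rw [twistOp_neg_apply, map_sub, apply_sharp_eq_flat, flat_swap (P y)]
    ring
  rw [h3] at h2
  linarith

/-- The Maurer-Cartan equation in the model space, at a point. -/
theorem extDeriv_add_half_koszulModel {P : Model n → CoModel n [⋀^Fin 2]→L[ℝ] ℝ}
    {w η : Model n → Model n [⋀^Fin 2]→L[ℝ] ℝ} {y : Model n} (hP : DifferentiableAt ℝ P y)
    (hw : DifferentiableAt ℝ w y) (hη : DifferentiableAt ℝ η y)
    (h : ∀ᶠ z in nhds y, ∀ X, flat (η z) (twistOp (-P z) (w z) X) = flat (w z) X)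
    (hT : IsUnit (twistOp (-P y) (w y))) (hclosed : extDeriv w y = 0)
    (hjac : schoutenModel (show 2 + 2 = 3 + 1 from rfl) P P y = 0) :
    extDeriv η y + (1 / 2 : ℝ) • koszulModel P (show 2 + 2 = 3 + 1 from rfl) η η y = 0 := by
  have hsurj : ∀ X, ∃ a, twistOp (-P y) (w y) a = X := by
    intro X
    obtain ⟨u, hu⟩ := hT
    refine ⟨(↑u⁻¹ : Model n →L[ℝ] Model n) X, ?_⟩
    rw [← hu]
    exact congrArg (fun L : Model n →L[ℝ] Model n => L X) u.mul_inv
  refine ext_vec_three fun X Y Z => ?_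
  -- Testing on the image of T lets η̃T = w̃ replace every undifferentiated η by w.
  obtain ⟨a, rfl⟩ := hsurj X
  obtain ⟨b, rfl⟩ := hsurj Y
  obtain ⟨c, rfl⟩ := hsurj Z
  rw [ContinuousAlternatingMap.add_apply, ContinuousAlternatingMap.smul_apply,
    extDeriv_vec_three, koszulModel_self_apply P η hP]
  simp only [h.self_of_nhds, smul_eq_mul]
  have hsplit : ∀ a b c, flat (fderiv ℝ η y (twistOp (-P y) (w y) a)) b c =
      flat (fderiv ℝ η y a) b c - flat (fderiv ℝ η y (sharp (P y) (flat (w y) a))) b c := by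
    intro a b c
    rw [twistOp_neg_apply, map_sub]
    simp [flat_apply]
  have hsplitP : ∀ a b c, flat (fderiv ℝ P y (twistOp (-P y) (w y) a)) b c =
      flat (fderiv ℝ P y a) b c - flat (fderiv ℝ P y (sharp (P y) (flat (w y) a))) b c := by
    intro a b c
    rw [twistOp_neg_apply, map_sub]
    simp [flat_apply]
  have hd := extDeriv_vec_three w y a b c
  have hj := schoutenModel_self_apply P y (flat (w y) a) (flat (w y) b) (flat (w y) c)
  rw [hclosed] at hd
  rw [hjac] at hj
  simp only [ContinuousAlternatingMap.coe_zero, Pi.zero_apply] at hd hj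
  rw [hsplit, hsplit, hsplit, hsplitP, hsplitP, hsplitP]
  simp only [flat_fderiv_twistOp hP hw hη h, ContinuousAlternatingMap.coe_zero, Pi.zero_apply]
  -- What remains is dw(a, b, c) minus half of [P, P](w̃a, w̃b, w̃c), namely `hd` and `hj`.
  linarith

/-! ### Smoothness and naturality of the gauge transformation -/

theorem flat_tau_twistOp (P : CoModel n [⋀^Fin 2]→L[ℝ] ℝ) (w : Model n [⋀^Fin 2]→L[ℝ] ℝ)
    (h : IsUnit (twistOp P w)) (X : Model n) : flat (tau P w h) (twistOp P w X) = flat w X := by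
  rw [flat_tau]
  exact congrArg (flat w)
    (congrArg (fun L : Model n →L[ℝ] Model n => L X) (Ring.inverse_mul_cancel (twistOp P w) h))

/-- The form `τ_P w` is determined by `η̃ T(P, w) = w̃`. -/
theorem eq_unflatL_of_flat_twistOp {P : CoModel n [⋀^Fin 2]→L[ℝ] ℝ}
    {w η : Model n [⋀^Fin 2]→L[ℝ] ℝ} (hT : IsUnit (twistOp P w))
    (h : ∀ X, flat η (twistOp P w X) = flat w X) :
    η = unflatL ((flat w).comp (Ring.inverse (twistOp P w))) := by
  rw [← flat_tau P w hT, unflatL_flat]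
  refine flat_injective ?_
  ext1 X
  have hX : twistOp P w (Ring.inverse (twistOp P w) X) = X :=
    congrArg (fun L : Model n →L[ℝ] Model n => L X) (Ring.mul_inverse_cancel (twistOp P w) hT)
  rw [← hX, h, flat_tau_twistOp]

theorem contDiffOn_of_flat_twistOp {P : Model n → CoModel n [⋀^Fin 2]→L[ℝ] ℝ}
    {w η : Model n → Model n [⋀^Fin 2]→L[ℝ] ℝ} {s : Set (Model n)} (hP : ContDiffOn ℝ ∞ P s)
    (hw : ContDiffOn ℝ ∞ w s) (hT : ∀ z ∈ s, IsUnit (twistOp (P z) (w z)))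
    (h : ∀ z ∈ s, ∀ X, flat (η z) (twistOp (P z) (w z) X) = flat (w z) X) :
    ContDiffOn ℝ ∞ η s := by
  have hflat : ContDiffOn ℝ ∞ (fun z => flat (w z)) s :=
    contDiff_flatL.comp_contDiffOn hw
  have hsharp : ContDiffOn ℝ ∞ (fun z => sharp (P z)) s := by
    simp only [← sharpL_apply]
    exact contDiff_sharpL.comp_contDiffOn hP
  have htwist : ContDiffOn ℝ ∞ (fun z => twistOp (P z) (w z)) s :=
    contDiffOn_const.add (hsharp.clm_comp hflat)
  have hinv : ContDiffOn ℝ ∞ (fun z => Ring.inverse (twistOp (P z) (w z))) s := by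
    intro z hz
    obtain ⟨u, hu⟩ := hT z hz
    -- `Ring.inverse` is zero off the units, but it is smooth at each unit, and T is a unit
    -- throughout `s`.
    have hu' := contDiffAt_ringInverse ℝ (n := ∞) u
    rw [hu] at hu'
    exact hu'.comp_contDiffWithinAt z (htwist z hz)
  refine (contDiff_unflatL.comp_contDiffOn (hflat.clm_comp hinv)).congr ?_
  exact fun z hz => eq_unflatL_of_flat_twistOp (hT z hz) (h z hz)

/-- Pushing a bivector forward along `D` and pulling a form back along the inverse `L` conjugates
`T(P, w)`. -/
theorem twistOp_comp (P : CoModel n [⋀^Fin 2]→L[ℝ] ℝ) (w : Model n [⋀^Fin 2]→L[ℝ] ℝ)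
    (D L : Model n →L[ℝ] Model n) (hDL : D.comp L = ContinuousLinearMap.id ℝ _)
    (hLD : L.comp D = ContinuousLinearMap.id ℝ _) :
    twistOp (P.compContinuousLinearMap (ContinuousLinearMap.precomp ℝ D))
      (w.compContinuousLinearMap L) = D.comp ((twistOp P w).comp L) := by
  have hD : ∀ X, D (L X) = X := fun X => congrArg (fun A : Model n →L[ℝ] Model n => A X) hDL
  have hL : ∀ X, L (D X) = X := fun X => congrArg (fun A : Model n →L[ℝ] Model n => A X) hLD
  ext1 X
  change X + sharp _ (flat _ X) = D (L X + sharp P (flat w (L X)))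
  rw [map_add, hD]
  congr 1
  have hf : flat (w.compContinuousLinearMap L) X = (flat w (L X)).comp L := by
    ext Y
    rw [flat_apply, ContinuousAlternatingMap.compContinuousLinearMap_apply, comp_vec_two]
    rfl
  refine model_ext fun b => ?_
  rw [apply_sharp_eq_flat, flat_apply, ContinuousAlternatingMap.compContinuousLinearMap_apply,
    comp_vec_two, hf]
  have h1 : ((flat w (L X)).comp L).comp D = flat w (L X) := by
    ext Y
    exact congrArg (flat w (L X)) (hL Y)
  change flat P (((flat w (L X)).comp L).comp D) (b.comp D) = _
  rw [h1, ← apply_sharp_eq_flat]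
  rfl

theorem isUnit_twistOp_comp {P : CoModel n [⋀^Fin 2]→L[ℝ] ℝ} {w : Model n [⋀^Fin 2]→L[ℝ] ℝ}
    (D L : Model n →L[ℝ] Model n) (hDL : D.comp L = ContinuousLinearMap.id ℝ _)
    (hLD : L.comp D = ContinuousLinearMap.id ℝ _) (hT : IsUnit (twistOp P w)) :
    IsUnit (twistOp (P.compContinuousLinearMap (ContinuousLinearMap.precomp ℝ D))
      (w.compContinuousLinearMap L)) := by
  rw [twistOp_comp P w D L hDL hLD]
  have hD : IsUnit D := ⟨⟨D, L, hDL, hLD⟩, rfl⟩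
  have hL : IsUnit L := ⟨⟨L, D, hLD, hDL⟩, rfl⟩
  exact hD.mul (hT.mul hL)

theorem flat_comp (w : Model n [⋀^Fin 2]→L[ℝ] ℝ) (L : Model n →L[ℝ] Model n) (X Y : Model n) :
    flat (w.compContinuousLinearMap L) X Y = flat w (L X) (L Y) := by
  rw [flat_apply, ContinuousAlternatingMap.compContinuousLinearMap_apply, comp_vec_two]
  rfl

theorem flat_tau_comp_twistOp {P : CoModel n [⋀^Fin 2]→L[ℝ] ℝ} {w : Model n [⋀^Fin 2]→L[ℝ] ℝ}
    (D L : Model n →L[ℝ] Model n) (hDL : D.comp L = ContinuousLinearMap.id ℝ _)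
    (hLD : L.comp D = ContinuousLinearMap.id ℝ _) (hT : IsUnit (twistOp P w)) (X : Model n) :
    flat ((tau P w hT).compContinuousLinearMap L)
      (twistOp (P.compContinuousLinearMap (ContinuousLinearMap.precomp ℝ D))
        (w.compContinuousLinearMap L) X) = flat (w.compContinuousLinearMap L) X := by
  have hL : ∀ X, L (D X) = X := fun X => congrArg (fun A : Model n →L[ℝ] Model n => A X) hLD
  ext1 Y
  rw [flat_comp, flat_comp, twistOp_comp P w D L hDL hLD, ContinuousLinearMap.comp_apply, hL,
    ContinuousLinearMap.comp_apply, flat_tau_twistOp]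

/-- Every tuple of vectors lifts through a surjective `L`. This lets an identity on a tangent space
be read in the chart. -/
theorem compContinuousLinearMap_injective {V W : Type*} [NormedAddCommGroup V] [NormedSpace ℝ V]
    [NormedAddCommGroup W] [NormedSpace ℝ W] {k : ℕ} {L : V →L[ℝ] W}
    (hL : Function.Surjective L) :
    Function.Injective fun α : W [⋀^Fin k]→L[ℝ] ℝ => α.compContinuousLinearMap L := by
  intro α β h
  ext v
  choose u hu using fun i => hL (v i)
  have hv : L ∘ u = v := funext hu
  have h1 := congrArg (fun γ : V [⋀^Fin k]→L[ℝ] ℝ => γ u) h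
  change α (L ∘ u) = β (L ∘ u) at h1
  rwa [hv] at h1

theorem precomp_surjective {D L : Model n →L[ℝ] Model n}
    (hDL : D.comp L = ContinuousLinearMap.id ℝ _) :
    Function.Surjective (ContinuousLinearMap.precomp ℝ L : CoModel n →L[ℝ] CoModel n) := by
  intro b
  refine ⟨b.comp D, ?_⟩
  ext X
  exact congrArg (fun A : Model n →L[ℝ] Model n => b (A X)) hDL

/-! ### Transfer between the manifold and its charts -/

section Manifold

variable {M : Type*} [TopologicalSpace M] [ChartedSpace (Model n) M] [IsManifold (𝓡 n) ∞ M]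

theorem chartDiff_comp_chartSymmDiff (x₀ : M) {y : Model n}
    (hy : y ∈ (chartAt (Model n) x₀).target) :
    (chartDiff x₀ ((chartAt (Model n) x₀).symm y)).comp (chartSymmDiff x₀ y) =
      ContinuousLinearMap.id ℝ (Model n) := by
  have : IsManifold (𝓡 n) 1 M := IsManifold.of_le (n := ∞) (by simp)
  exact (mdifferentiable_chart (I := 𝓡 n) x₀).comp_symm_deriv hy

theorem chartSymmDiff_comp_chartDiff (x₀ : M) {y : Model n}
    (hy : y ∈ (chartAt (Model n) x₀).target) :
    (chartSymmDiff x₀ y).comp (chartDiff x₀ ((chartAt (Model n) x₀).symm y)) =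
      ContinuousLinearMap.id ℝ (Model n) := by
  have : IsManifold (𝓡 n) 1 M := IsManifold.of_le (n := ∞) (by simp)
  have h := (mdifferentiable_chart (I := 𝓡 n) x₀).symm_comp_deriv
    ((chartAt (Model n) x₀).map_target hy)
  rw [(chartAt (Model n) x₀).right_inv hy] at h
  exact h

theorem chartDiff_self_comp_chartSymmDiff (x : M) :
    ContinuousLinearMap.comp (chartDiff x x : Model n →L[ℝ] Model n)
      (chartSymmDiff x (chartAt (Model n) x x) : Model n →L[ℝ] Model n) =
      ContinuousLinearMap.id ℝ (Model n) := by
  have h := chartDiff_comp_chartSymmDiff x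
    ((chartAt (Model n) x).map_source (mem_chart_source (Model n) x))
  rw [(chartAt (Model n) x).left_inv (mem_chart_source (Model n) x)] at h
  exact h

theorem formFromChart_injective {k : ℕ} (x : M) :
    Function.Injective (formFromChart (n := n) (k := k) x) :=
  compContinuousLinearMap_injective (V := Model n) (W := Model n) (L := chartDiff x x)
    fun X => ⟨chartSymmDiff x (chartAt (Model n) x x) X,
      congrArg (fun A : Model n →L[ℝ] Model n => A X) (chartDiff_self_comp_chartSymmDiff x)⟩

theorem multivectorFromChart_injective {k : ℕ} (x : M) :
    Function.Injective (multivectorFromChart (n := n) (k := k) x) :=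
  compContinuousLinearMap_injective (V := CoModel n) (W := CoModel n)
    (precomp_surjective (chartDiff_self_comp_chartSymmDiff x))

theorem isUnit_twistOp_inChart (π : MultivectorField n M 2) (Ω : DiffForm n M 2)
    (h : ∀ x : M, IsUnit (twistAt π Ω x)) (x₀ : M) {y : Model n}
    (hy : y ∈ (chartAt (Model n) x₀).target) :
    IsUnit (twistOp (multivectorInChart π x₀ y) (formInChart Ω x₀ y)) :=
  isUnit_twistOp_comp _ _ (chartDiff_comp_chartSymmDiff x₀ hy) (chartSymmDiff_comp_chartDiff x₀ hy)
    (h _)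

/-- The chart differentials are mutually inverse on the whole target, so the relation holds on an
open set and can be differentiated there. -/
theorem flat_tauForm_inChart (π : MultivectorField n M 2) (Ω : DiffForm n M 2)
    (h : ∀ x : M, IsUnit (twistAt π Ω x)) (x₀ : M) {y : Model n}
    (hy : y ∈ (chartAt (Model n) x₀).target) (X : Model n) :
    flat (formInChart (tauForm π Ω h) x₀ y)
      (twistOp (multivectorInChart π x₀ y) (formInChart Ω x₀ y) X) =
      flat (formInChart Ω x₀ y) X :=
  flat_tau_comp_twistOp _ _ (chartDiff_comp_chartSymmDiff x₀ hy)
    (chartSymmDiff_comp_chartDiff x₀ hy) (h _) X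

theorem isSmoothForm_tauForm {π : MultivectorField n M 2} (hπ : IsSmoothMultivectorField π)
    {Ω : DiffForm n M 2} (hΩ : IsSmoothForm Ω) (h : ∀ x : M, IsUnit (twistAt π Ω x)) :
    IsSmoothForm (tauForm π Ω h) := fun x₀ =>
  contDiffOn_of_flat_twistOp (hπ x₀) (hΩ x₀)
    (fun _ hz => isUnit_twistOp_inChart π Ω h x₀ hz) fun _ hz => flat_tauForm_inChart π Ω h x₀ hz

end Manifold

end PoissonGauge

end

open PoissonGauge in
theorem mainTheorem9 {n : ℕ} {M : Type*} [TopologicalSpace M]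
    [ChartedSpace (EuclideanSpace ℝ (Fin n)) M] [IsManifold (𝓡 n) ∞ M]
    (π : PoissonGauge.MultivectorField n M 2) (hπ : PoissonGauge.IsPoisson π)
    (Ω : PoissonGauge.DiffForm n M 2) (hΩ : PoissonGauge.IsSmoothForm Ω)
    (hclosed : PoissonGauge.extD Ω = 0)
    (hT : ∀ x : M, IsUnit (PoissonGauge.twistAt (-π) Ω x)) :
    PoissonGauge.IsSmoothForm (PoissonGauge.tauForm (-π) Ω hT) ∧
      PoissonGauge.extD (PoissonGauge.tauForm (-π) Ω hT) +
        (1 / 2 : ℝ) • PoissonGauge.koszul π (show 2 + 2 = 3 + 1 from rfl)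
          (PoissonGauge.tauForm (-π) Ω hT) (PoissonGauge.tauForm (-π) Ω hT) = 0 := by
  have hneg : IsSmoothMultivectorField (-π) := fun x₀ => (hπ.1 x₀).neg
  have hsmooth := isSmoothForm_tauForm hneg hΩ hT
  refine ⟨hsmooth, ?_⟩
  funext x
  have hy : chartAt (EuclideanSpace ℝ (Fin n)) x x ∈
      (chartAt (EuclideanSpace ℝ (Fin n)) x).target :=
    (chartAt (EuclideanSpace ℝ (Fin n)) x).map_source (mem_chart_source _ x)
  have hnhds := (chartAt (EuclideanSpace ℝ (Fin n)) x).open_target.mem_nhds hy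
  -- The differential of the chart at its own base point is onto, so closedness and the Jacobi
  -- identity at x pass to the chart expressions.
  have hd : extDeriv (formInChart Ω x) (chartAt (EuclideanSpace ℝ (Fin n)) x x) = 0 :=
    formFromChart_injective x (congrFun hclosed x)
  have hj : schoutenModel (show 2 + 2 = 3 + 1 from rfl) (multivectorInChart π x)
      (multivectorInChart π x) (chartAt (EuclideanSpace ℝ (Fin n)) x x) = 0 :=
    multivectorFromChart_injective x (congrFun hπ.2 x)
  have key := extDeriv_add_half_koszulModel
    (((hπ.1 x).contDiffAt hnhds).differentiableAt (by simp))
    (((hΩ x).contDiffAt hnhds).differentiableAt (by simp))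
    (((hsmooth x).contDiffAt hnhds).differentiableAt (by simp))
    (Filter.mem_of_superset hnhds fun z hz => flat_tauForm_inChart (-π) Ω hT x hz)
    (isUnit_twistOp_inChart (-π) Ω hT x hy) hd hj
  -- Pullback is linear, so the chart identity at the image of x is the required identity at x.
  exact congrArg (formFromChart x) key
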